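/- Let $\Lambda$ be a principal ideal domain, $p\in\Lambda$ a prime element, $B$ a finitely generated $\Lambda$-module and $A\subseteq B$ a submodule with $p^2A=0$. Here a pair $(B;A)$ consists of a $\Lambda$-module $B$ and a submodule $A$ of $B$; an isomorphism $(B;A)\cong(D;C)$ is a $\Lambda$-isomorphism $f\colon B\to D$ with $f(A)=C$; the pair $(B;A)$ is the direct sum of the pairs $(B_i;A\cap B_i)$ given by submodules $B_i\subseteq B$ if $B=\bigoplus_i B_i$ and $A=\bigoplus_i (A\cap B_i)$; and a pair is indecomposable if its ambient module is nonzero and it is not the direct sum of two pairs with nonzero ambient modules. Consider the following pairs: (a) $(\Lambda/(q);0)$, where $q$ is a prime power (with positive exponent) relatively prime to $p$; (b) the pickets $P^\ell_m=(\Lambda/(p^\ell);\,p^{\ell-m}\Lambda/(p^\ell))$ with $\ell\ge 1$ and $0\le m\le\min(\ell,2)$, and the pairs $Q^t_s=\bigl(\Lambda/(p^t)\oplus\Lambda/(p^s);\,(p^{t-2},p^{s-1})\Lambda\bigr)$ with $1\le s<t-1$; (c) $(\Lambda;0)$. All these pairs are indecomposable. The pair $(B;A)$ is a direct sum of finitely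 many indecomposable pairs, each isomorphic to a pair in (a), (b) or (c). This decomposition is unique up to isomorphism and reordering: for any two decompositions of $(B;A)$ into finitely many indecomposable pairs there is a bijection between the summands such that corresponding summands are isomorphic. -/

import Mathlib

universe u v

/-! A pair `(B; A)` consists of a `Λ`-module `B` and a submodule `A` of `B`. Since the type of
`A : Submodule Λ B` mentions `B`, a pair is given by the term `A`. -/

namespace SubPair

section Basic

variable {Λ : Type*} [CommRing Λ] {B : Type*} [AddCommGroup B] [Module Λ B]
  {D : Type*} [AddCommGroup D] [Module Λ D]

/-- The pairs `(B; A)` and `(D; C)` are isomorphic: there is an isomorphism `B → D` of modules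
that maps `A` onto `C`. -/
def Iso (A : Submodule Λ B) (C : Submodule Λ D) : Prop :=
  ∃ e : B ≃ₗ[Λ] D, A.map (e : B →ₗ[Λ] D) = C

/-- The pair `(B; A)` is the (internal) direct sum of the pairs `(N i; A ∩ N i)`: the module `B`
is the direct sum of the submodules `N i`, and `A` is the sum of the `A ∩ N i`. -/
structure IsDirectSum {ι : Type*} (A : Submodule Λ B) (N : ι → Submodule Λ B) : Prop where
  indep : iSupIndep N
  iSup_eq_top : ⨆ i, N i = ⊤
  iSup_inf_eq : ⨆ i, A ⊓ N i = A

/-- The pair `(B; A)` is indecomposable: it is nonzero, and in every decomposition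
`(B; A) = (U; A ∩ U) ⊕ (V; A ∩ V)` one of the two summands is zero. -/
def Indecomposable (A : Submodule Λ B) : Prop :=
  Nontrivial B ∧
    ∀ U V : Submodule Λ B, IsCompl U V → (A ⊓ U) ⊔ (A ⊓ V) = A → U = ⊥ ∨ V = ⊥

/-- The summand `(N; A ∩ N)` of `(B; A)`, where `A ∩ N` is regarded as a submodule of `N`. -/
abbrev summand (A N : Submodule Λ B) : Submodule Λ N := A.submoduleOf N

end Basic

section Types

variable {Λ : Type*} [CommRing Λ]

/-- The picket `P^ℓ_m = (Λ/(p^ℓ); p^(ℓ-m) Λ/(p^ℓ))`, for `m ≤ ℓ`: the ambient module has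
length `ℓ` and the submodule has length `m`. -/
def picket (p : Λ) (ℓ m : ℕ) : Submodule Λ (Λ ⧸ Ideal.span {p ^ ℓ}) :=
  Submodule.span Λ {Ideal.Quotient.mk (Ideal.span {p ^ ℓ}) (p ^ (ℓ - m))}

/-- The pair `Q^t_s = (Λ/(p^t) ⊕ Λ/(p^s); (p^(t-2), p^(s-1)) Λ)`, for `1 ≤ s < t - 1`. -/
def qPair (p : Λ) (t s : ℕ) :
    Submodule Λ ((Λ ⧸ Ideal.span {p ^ t}) × (Λ ⧸ Ideal.span {p ^ s})) :=
  Submodule.span Λ {(Ideal.Quotient.mk (Ideal.span {p ^ t}) (p ^ (t - 2)),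
    Ideal.Quotient.mk (Ideal.span {p ^ s}) (p ^ (s - 1)))}

variable {D : Type*} [AddCommGroup D] [Module Λ D]

/-- `(D; C)` is of type `(Λ/(q); 0)` with `q` a prime power relatively prime to `p`. -/
def IsCoprimeType (p : Λ) (C : Submodule Λ D) : Prop :=
  ∃ q : Λ, IsPrimePow q ∧ IsCoprime q p ∧ Iso C (⊥ : Submodule Λ (Λ ⧸ Ideal.span {q}))

/-- `(D; C)` is of type `P^ℓ_m` with `1 ≤ ℓ` and `m ≤ min(ℓ, 2)`. -/
def IsPicketType (p : Λ) (C : Submodule Λ D) : Prop :=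
  ∃ ℓ m : ℕ, 1 ≤ ℓ ∧ m ≤ ℓ ∧ m ≤ 2 ∧ Iso C (picket p ℓ m)

/-- `(D; C)` is of type `Q^t_s` with `1 ≤ s < t - 1`. -/
def IsQType (p : Λ) (C : Submodule Λ D) : Prop :=
  ∃ t s : ℕ, 1 ≤ s ∧ s + 1 < t ∧ Iso C (qPair p t s)

/-- `(D; C)` is of type `(Λ; 0)`. -/
def IsFreeType (C : Submodule Λ D) : Prop :=
  Iso C (⊥ : Submodule Λ Λ)

/-- `(D; C)` is of one of the types in the classification. -/
def IsListed (p : Λ) (C : Submodule Λ D) : Prop :=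
  IsCoprimeType p C ∨ (IsPicketType p C ∨ IsQType p C) ∨ IsFreeType C

end Types

end SubPair

/-!
A pair `(B; A)` is indecomposable exactly when `0` and `1` are the only idempotent endomorphisms of
`B ≠ 0` preserving `A`. Hence an indecomposable pair which has a retraction onto a nonzero pair is
isomorphic to it.

To recognize an indecomposable pair, it thus suffices to split off one pair of the list. A map from
a submodule of `B` to `Λ/(q)` extends to `B` as soon as it kills the elements of `q B`, because
`Λ/(q)` is a self-injective ring. If `A = 0`, either `B` is torsion free, hence free, or a torsion
element splits off a cyclic summand. If `p A = 0 ≠ A`, an element of `A` of finite height splits off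
a picket `P^ℓ_1`. Otherwise, if multiplication by `p` raises the height of some element of `A` by
one only, that element gives a picket `P^ℓ_2`. In the remaining case, take the smallest height of a
nonzero `p x` with `x ∈ A` and, among the elements `x` attaining it, the greatest height of `x`:
then `x = p^(t-2) u + p^(s-1) w`, and `u`, `w` split off a `Q^t_s`.

Conversely, for a listed pair, an idempotent preserving `A` acts as `0` or `1` on a generator of `A`
(or of `B` if `B` is cyclic). After exchanging `e` and `1 - e`, the idempotent acts as `0`. For
`Q^t_s` its image then consists of multiples of `p`, so it is nilpotent and vanishes.

Existence of a decomposition is Noetherian induction. For uniqueness, the torsion summands have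
finite length, so by Fitting's lemma their endomorphism rings are local and the Krull–Remak–Schmidt
exchange argument applies; the free summands are counted by the rank of `B`.
-/

namespace SubPair

section Retract

variable {Λ : Type*} [CommRing Λ] {B : Type*} [AddCommGroup B] [Module Λ B]
  {D : Type*} [AddCommGroup D] [Module Λ D] {F : Type*} [AddCommGroup F] [Module Λ F]
  {A : Submodule Λ B} {C : Submodule Λ D} {G : Submodule Λ F}

theorem Iso.symm (h : Iso A C) : Iso C A := by
  obtain ⟨e, rfl⟩ := h
  exact ⟨e.symm, by ext; simp⟩

theorem Iso.trans (h : Iso A C) (h' : Iso C G) : Iso A G := by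
  obtain ⟨e, rfl⟩ := h
  obtain ⟨e', rfl⟩ := h'
  exact ⟨e.trans e', by rw [← Submodule.map_comp, LinearEquiv.coe_trans]⟩

theorem indecomposable_iff_isIdempotentElem [Nontrivial B] :
    Indecomposable A ↔
      ∀ e : Module.End Λ B, IsIdempotentElem e → A ≤ A.comap e → e = 0 ∨ e = 1 := by
  constructor
  · rintro ⟨-, hA⟩ e he hAe
    have hsup : A ⊓ LinearMap.range e ⊔ A ⊓ LinearMap.ker e = A := by
      refine le_antisymm (sup_le inf_le_left inf_le_left) fun a ha => ?_
      have hker : e (a - e a) = 0 := by rw [map_sub, ← Module.End.mul_apply, he.eq, sub_self]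
      rw [← add_sub_cancel (e a) a]
      exact Submodule.add_mem_sup ⟨hAe ha, e.mem_range_self a⟩ ⟨A.sub_mem ha (hAe ha), hker⟩
    refine (hA _ _ (LinearMap.IsIdempotentElem.isCompl he) hsup).imp LinearMap.range_eq_bot.mp
      fun hker => LinearMap.ext fun b => ?_
    refine LinearMap.ker_eq_bot.mp hker ?_
    rw [← Module.End.mul_apply, he.eq, Module.End.one_apply]
  · refine fun h => ⟨inferInstance, fun U V hUV hA => ?_⟩
    have hπ : A ≤ A.comap (U.projection V hUV) := by
      conv_lhs => rw [← hA]
      refine sup_le (fun a ha => ?_) fun a ha => ?_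
      · simpa [Submodule.projection_apply_of_mem_left hUV ha.2] using ha.1
      · simp [Submodule.projection_apply_of_mem_right hUV ha.2]
    refine (h _ (Submodule.isIdempotentElem_projection hUV) hπ).imp (fun h0 => ?_) fun h1 => ?_
    · rw [← Submodule.range_projection hUV, h0, LinearMap.range_zero]
    · rw [← Submodule.ker_projection hUV, h1]
      exact LinearMap.ker_id

theorem Indecomposable.comp_eq_id_of_retract [Nontrivial D] (hA : Indecomposable A)
    {i : D →ₗ[Λ] B} {r : B →ₗ[Λ] D} (hri : r ∘ₗ i = LinearMap.id) (hi : C.map i ≤ A)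
    (hr : A.map r ≤ C) : i ∘ₗ r = LinearMap.id := by
  have hri' (d : D) : r (i d) = d := LinearMap.congr_fun hri d
  have := hA.1
  have hAe : A ≤ A.comap (i ∘ₗ r) := fun a ha =>
    hi (Submodule.mem_map_of_mem (hr (Submodule.mem_map_of_mem ha)))
  refine (indecomposable_iff_isIdempotentElem.mp hA (i ∘ₗ r) ?_ hAe).resolve_left fun h0 => ?_
  · ext b
    simp only [Module.End.mul_apply, LinearMap.comp_apply, hri']
  · obtain ⟨d, hd⟩ := exists_ne (0 : D)
    exact hd (by simpa only [LinearMap.comp_apply, hri', LinearMap.zero_apply, map_zero]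
      using congr(r ($h0 (i d))))

theorem Indecomposable.iso_of_retract [Nontrivial D] (hA : Indecomposable A)
    {i : D →ₗ[Λ] B} {r : B →ₗ[Λ] D} (hri : r ∘ₗ i = LinearMap.id) (hi : C.map i ≤ A)
    (hr : A.map r ≤ C) : Iso A C := by
  have hir := hA.comp_eq_id_of_retract hri hi hr
  refine ⟨.ofLinearMap r i hri hir, le_antisymm hr ?_⟩
  calc C = (C.map i).map r := by rw [← Submodule.map_comp, hri, Submodule.map_id]
    _ ≤ A.map r := Submodule.map_mono hi

theorem Iso.indecomposable (h : Iso A C) (hC : Indecomposable C) : Indecomposable A := by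
  obtain ⟨e, rfl⟩ := h
  refine ⟨have := hC.1; e.toEquiv.nontrivial, fun U V hUV hA => ?_⟩
  have hcompl : IsCompl (U.map (e : B →ₗ[Λ] D)) (V.map (e : B →ₗ[Λ] D)) :=
    hUV.map (Submodule.orderIsoMapComap e)
  have hinf (W : Submodule Λ B) :
      A.map (e : B →ₗ[Λ] D) ⊓ W.map (e : B →ₗ[Λ] D) = (A ⊓ W).map (e : B →ₗ[Λ] D) :=
    (Submodule.map_inf _ e.injective).symm
  simpa using hC.2 _ _ hcompl (by rw [hinf, hinf, ← Submodule.map_sup, hA])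

end Retract

section Multiples

variable {Λ : Type*} [CommRing Λ] {B : Type*} [AddCommGroup B] [Module Λ B]

/-- The submodule `r B` of the multiples of `r`, in the form for which `B ⧸ r B` is a module over
`Λ ⧸ (r)`. -/
abbrev multiples (r : Λ) (B : Type*) [AddCommGroup B] [Module Λ B] : Submodule Λ B :=
  Ideal.span {r} • ⊤

theorem mem_multiples {r : Λ} {b : B} : b ∈ multiples r B ↔ ∃ c, r • c = b := by
  simp [multiples, Submodule.ideal_span_singleton_smul, Submodule.mem_smul_pointwise_iff_exists]

theorem smul_mem_multiples (r : Λ) (b : B) : r • b ∈ multiples r B :=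
  mem_multiples.mpr ⟨b, rfl⟩

theorem smul_mem_multiples_mul (r : Λ) {s : Λ} {b : B} (hb : b ∈ multiples s B) :
    r • b ∈ multiples (r * s) B := by
  obtain ⟨c, rfl⟩ := mem_multiples.mp hb
  rw [← mul_smul]
  exact smul_mem_multiples _ _

theorem map_mem_multiples {D : Type*} [AddCommGroup D] [Module Λ D] {r : Λ} {b : B}
    (f : B →ₗ[Λ] D) (hb : b ∈ multiples r B) : f b ∈ multiples r D := by
  obtain ⟨c, rfl⟩ := mem_multiples.mp hb
  rw [map_smul]
  exact smul_mem_multiples _ _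

theorem multiples_mono {r s : Λ} (h : r ∣ s) : multiples s B ≤ multiples r B :=
  Submodule.smul_mono_left (Ideal.span_singleton_le_span_singleton.mpr h)

theorem mem_multiples_pow_of_le {p : Λ} {m n : ℕ} (h : n ≤ m) {b : B}
    (hb : b ∈ multiples (p ^ m) B) : b ∈ multiples (p ^ n) B :=
  multiples_mono (pow_dvd_pow p h) hb

theorem exists_notMem_multiples [IsNoetherianRing Λ] [Module.Finite Λ B] {p : Λ} {x : B}
    (hx : x ≠ 0) (hpx : p • x = 0) : ∃ n, x ∉ multiples (p ^ n) B := by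
  by_contra! hall
  have hmem : x ∈ (⨅ i : ℕ, Ideal.span {p} ^ i • ⊤ : Submodule Λ B) :=
    (Submodule.mem_iInf _).mpr fun i => by simpa only [Ideal.span_singleton_pow] using hall i
  obtain ⟨⟨r, hr⟩, hrx⟩ := (Ideal.mem_iInf_smul_pow_eq_bot_iff _ x).mp hmem
  obtain ⟨q, rfl⟩ := Ideal.mem_span_singleton.mp hr
  apply hx
  calc x = (p * q) • x := hrx.symm
    _ = 0 := by rw [mul_comm, mul_smul, hpx, smul_zero]

theorem exists_pow_smul_eq_and_notMem [IsNoetherianRing Λ] [Module.Finite Λ B] {p : Λ} {x : B}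
    (hx : x ≠ 0) (hpx : p • x = 0) :
    ∃ (n : ℕ) (c : B), p ^ n • c = x ∧ p ^ n • c ∉ multiples (p ^ (n + 1)) B := by
  classical
  have h := exists_notMem_multiples hx hpx
  obtain ⟨n, hn⟩ : ∃ n, Nat.find h = n + 1 := by
    refine Nat.exists_eq_succ_of_ne_zero fun h0 => Nat.find_spec h ?_
    rw [h0, pow_zero]
    exact mem_multiples.mpr ⟨x, one_smul _ _⟩
  obtain ⟨c, rfl⟩ := mem_multiples.mp (not_not.mp (Nat.find_min h (m := n) (by omega)))
  exact ⟨n, c, rfl, hn ▸ Nat.find_spec h⟩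

end Multiples

section Extension

theorem exists_comp_eq_of_baer {R : Type*} [Ring R] {Q M N : Type*} [AddCommGroup Q]
    [Module R Q] [AddCommGroup M] [Module R M] [AddCommGroup N] [Module R N]
    (hQ : Module.Baer R Q) {φ : M →ₗ[R] N} {g : M →ₗ[R] Q}
    (h : LinearMap.ker φ ≤ LinearMap.ker g) : ∃ f : N →ₗ[R] Q, f ∘ₗ φ = g := by
  obtain ⟨f, hf⟩ := hQ.extension_property ((LinearMap.ker φ).liftQ φ le_rfl)
    (LinearMap.ker_eq_bot.mp (Submodule.ker_liftQ_eq_bot _ _ _ le_rfl))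
    ((LinearMap.ker φ).liftQ g h)
  exact ⟨f, LinearMap.ext fun m => LinearMap.congr_fun hf (Submodule.Quotient.mk m)⟩

theorem baer_of_forall_exists_smul_eq {R : Type*} [CommRing R] [IsPrincipalIdealRing R] {Q : Type*}
    [AddCommGroup Q] [Module R Q]
    (h : ∀ (a : R) (y : Q), (∀ r, r * a = 0 → r • y = 0) → ∃ z, a • z = y) : Module.Baer R Q := by
  intro I g
  obtain ⟨a, rfl⟩ := (IsPrincipalIdealRing.principal I).principal
  let a' : Submodule.span R {a} := ⟨a, Submodule.mem_span_singleton_self a⟩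
  obtain ⟨z, hz⟩ := h a (g a') fun r hr => by
    rw [← map_smul, show r • a' = 0 from Subtype.ext hr, map_zero]
  refine ⟨LinearMap.toSpanSingleton R Q z, fun x hx => ?_⟩
  obtain ⟨r, rfl⟩ := Submodule.mem_span_singleton.mp hx
  rw [LinearMap.toSpanSingleton_apply, smul_assoc, hz, ← map_smul]
  rfl

variable {Λ : Type*} [CommRing Λ] [IsDomain Λ] [IsPrincipalIdealRing Λ]

theorem baer_quotient_span_singleton {q : Λ} (hq : q ≠ 0) :
    Module.Baer (Λ ⧸ Ideal.span {q}) (Λ ⧸ Ideal.span {q}) := by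
  have := IsPrincipalIdealRing.of_surjective _ (Ideal.Quotient.mk_surjective (I := Ideal.span {q}))
  refine baer_of_forall_exists_smul_eq fun x y h => ?_
  obtain ⟨a, rfl⟩ := Ideal.Quotient.mk_surjective x
  obtain ⟨b, rfl⟩ := Ideal.Quotient.mk_surjective y
  obtain ⟨α, β, hd⟩ := IsBezout.gcd_eq_sum a q
  obtain ⟨a', ha'⟩ := IsBezout.gcd_dvd_left a q
  obtain ⟨q', hq'⟩ := IsBezout.gcd_dvd_right a q
  set d := IsBezout.gcd a q
  have hdb : d ∣ b := by
    have hq'b : q ∣ q' * b := by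
      rw [← Ideal.Quotient.eq_zero_iff_dvd, map_mul]
      refine h _ ?_
      rw [← map_mul, Ideal.Quotient.eq_zero_iff_dvd]
      exact ⟨a', by linear_combination q' * ha' - a' * hq'⟩
    rw [hq', mul_comm d] at hq'b
    exact (mul_dvd_mul_iff_left (right_ne_zero_of_mul (hq' ▸ hq))).mp hq'b
  obtain ⟨w, rfl⟩ := hdb
  refine ⟨Ideal.Quotient.mk _ (α * w), ?_⟩
  rw [smul_eq_mul, ← map_mul, Ideal.Quotient.mk_eq_mk_iff_sub_mem, Ideal.mem_span_singleton]
  exact ⟨-β * w, by linear_combination w * hd⟩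

variable {B : Type*} [AddCommGroup B] [Module Λ B]

theorem exists_extension {S : Type*} [AddCommGroup S] [Module Λ S] {q : Λ} (hq : q ≠ 0)
    (φ : S →ₗ[Λ] B) (g : S →ₗ[Λ] Λ ⧸ Ideal.span {q})
    (h : ∀ s, φ s ∈ multiples q B → g s = 0) :
    ∃ f : B →ₗ[Λ] Λ ⧸ Ideal.span {q}, f ∘ₗ φ = g := by
  let I := Ideal.span {q}
  have hφ : multiples q S ≤ (multiples q B).comap φ := fun s hs => map_mem_multiples φ hs
  have hsurj : Function.Surjective (algebraMap Λ (Λ ⧸ I)) := Ideal.Quotient.mk_surjective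
  let φ' := ((multiples q S).mapQ (multiples q B) φ hφ).extendScalarsOfSurjective hsurj
  have hg : multiples q S ≤ LinearMap.ker g := fun s hs => h s (hφ hs)
  let g' := ((multiples q S).liftQ g hg).extendScalarsOfSurjective hsurj
  obtain ⟨f, hf⟩ := exists_comp_eq_of_baer (baer_quotient_span_singleton hq) (φ := φ') (g := g')
    fun x hx => by
      obtain ⟨s, rfl⟩ := Submodule.Quotient.mk_surjective _ x
      exact h s ((Submodule.Quotient.mk_eq_zero _).mp hx)
  exact ⟨f.restrictScalars Λ ∘ₗ (multiples q B).mkQ,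
    LinearMap.ext fun s => LinearMap.congr_fun hf (Submodule.Quotient.mk s)⟩

end Extension

section Cyclic

variable {Λ : Type*} [CommRing Λ] {B : Type*} [AddCommGroup B] [Module Λ B]

/-- The linear map `Λ / (q) → B` that sends `1` to an element `c` with `q c = 0`. -/
def cyclicLift {q : Λ} {c : B} (h : q • c = 0) : (Λ ⧸ Ideal.span {q}) →ₗ[Λ] B :=
  Submodule.liftQSpanSingleton q (LinearMap.toSpanSingleton Λ B c) h

theorem nontrivial_quotient_pow {p : Λ} (hp : Prime p) {n : ℕ} (hn : n ≠ 0) :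
    Nontrivial (Λ ⧸ Ideal.span {p ^ n}) := by
  rw [Ideal.Quotient.nontrivial_iff, Ne, Ideal.span_singleton_eq_top, isUnit_pow_iff hn]
  exact hp.not_isUnit

variable [IsDomain Λ]

theorem mem_span_mk_of_smul_eq_zero {q r s : Λ} (hr : r ≠ 0) (hrs : r * s = q)
    {y : Λ ⧸ Ideal.span {q}} (hy : r • y = 0) :
    y ∈ Submodule.span Λ {Ideal.Quotient.mk (Ideal.span {q}) s} := by
  subst hrs
  obtain ⟨z, rfl⟩ := Ideal.Quotient.mk_surjective y
  obtain ⟨c, rfl⟩ : s ∣ z :=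
    (mul_dvd_mul_iff_left hr).mp ((Ideal.Quotient.eq_zero_iff_dvd _ _).mp hy)
  exact Submodule.mem_span_singleton.mpr ⟨c, congrArg _ (mul_comm c s)⟩

variable [IsPrincipalIdealRing Λ] {p : Λ}

theorem exists_mul_add_eq_pow (hp : Prime p) {n : ℕ} {r : Λ} (hr : ¬ p ^ n ∣ r) :
    ∃ j < n, ∃ a b : Λ, a * r + b * p ^ n = p ^ j := by
  obtain ⟨j, hj, hd⟩ := (dvd_prime_pow hp n).mp (IsBezout.gcd_dvd_right r (p ^ n))
  have hjn : j ≠ n := by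
    rintro rfl
    exact hr (hd.symm.dvd.trans (IsBezout.gcd_dvd_left _ _))
  obtain ⟨u, hu⟩ := hd
  obtain ⟨a, b, hab⟩ := IsBezout.gcd_eq_sum r (p ^ n)
  exact ⟨j, by omega, u * a, u * b, by linear_combination (u : Λ) * hab + hu⟩

theorem dvd_of_smul_mem (hp : Prime p) {N : Submodule Λ B} {n : ℕ} {c : B}
    (hc : p ^ (n + 1) • c ∈ N) (hc' : p ^ n • c ∉ N) {r : Λ} (hr : r • c ∈ N) :
    p ^ (n + 1) ∣ r := by
  by_contra hdvd
  obtain ⟨j, hj, a, b, hab⟩ := exists_mul_add_eq_pow hp hdvd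
  have hjc : p ^ j • c ∈ N := by
    rw [← hab, add_smul, mul_smul, mul_smul]
    exact N.add_mem (N.smul_mem a hr) (N.smul_mem b hc)
  rw [← Nat.sub_add_cancel (Nat.le_of_lt_succ hj), pow_add, mul_smul] at hc'
  exact hc' (N.smul_mem _ hjc)

theorem Indecomposable.iso_picket {A : Submodule Λ B} (hA : Indecomposable A) (hp : Prime p)
    {m k : ℕ} (hk : k ≤ m + 1) {c : B} (hc : p ^ (m + 1) • c = 0)
    (hmc : p ^ m • c ∉ multiples (p ^ (m + 1)) B) (hcA : p ^ (m + 1 - k) • c ∈ A)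
    (hAk : ∀ a ∈ A, p ^ k • a = 0) : Iso A (picket p (m + 1) k) := by
  have hdvd {r : Λ} (hr : r • c ∈ multiples (p ^ (m + 1)) B) : p ^ (m + 1) ∣ r :=
    dvd_of_smul_mem hp (by rw [hc]; exact zero_mem _) hmc hr
  obtain ⟨f, hf⟩ := exists_extension (pow_ne_zero _ hp.ne_zero) (cyclicLift hc) LinearMap.id
    fun y hy => by
      obtain ⟨r, rfl⟩ := Ideal.Quotient.mk_surjective y
      exact (Ideal.Quotient.eq_zero_iff_dvd _ _).mpr (hdvd hy)
  have := nontrivial_quotient_pow hp m.succ_ne_zero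
  refine hA.iso_of_retract hf ?_ ?_
  · rw [picket, Submodule.map_span_le]
    rintro _ rfl
    exact hcA
  · rintro _ ⟨a, ha, rfl⟩
    refine mem_span_mk_of_smul_eq_zero (pow_ne_zero k hp.ne_zero) (pow_mul_pow_sub p hk) ?_
    rw [← map_smul, hAk a ha, map_zero]

end Cyclic

section QType

variable {Λ : Type*} [CommRing Λ] {B : Type*} [AddCommGroup B] [Module Λ B] {p : Λ}
  {A : Submodule Λ B}

/-- Multiplication by `p` raises the `p`-height in `B` of the elements of `A` by at least two. A
failure of this condition gives rise to a summand `P^ℓ_2`. -/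
def IsGapped (p : Λ) (A : Submodule Λ B) : Prop :=
  ∀ x ∈ A, ∀ n, x ∈ multiples (p ^ n) B → p • x ∈ multiples (p ^ (n + 2)) B

/-- The elements `u` and `w` generate a submodule of `B` isomorphic to `Λ/(p^(t+2)) ⊕ Λ/(p^(s+1))`
in which `p^t u + p^s w ∈ A` corresponds to the generator of `Q^(t+2)_(s+1)`. By the condition
`maximal`, no element of `A` of greater height than `p^t u + p^s w` would do. -/
structure IsQBasis (p : Λ) (A : Submodule Λ B) (t s : ℕ) (u w : B) : Prop where
  lt : s < t
  mem : p ^ t • u + p ^ s • w ∈ A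
  smul_left : p ^ (t + 2) • u = 0
  smul_right : p ^ (s + 1) • w = 0
  left_notMem : p ^ (t + 1) • u ∉ multiples (p ^ (t + 2)) B
  right_notMem : p ^ s • w ∉ multiples (p ^ (s + 1)) B
  maximal : ∀ a ∈ A, a ∈ multiples (p ^ (s + 1)) B → p • a ∈ multiples (p ^ (t + 2)) B

theorem IsGapped.exists_extremal (hgap : IsGapped p A)
    (hex : ∃ n, ∃ x ∈ A, p • x ∉ multiples (p ^ n) B) :
    ∃ t s : ℕ, s < t ∧ (∃ x ∈ A, x ∈ multiples (p ^ s) B ∧ p • x ∈ multiples (p ^ (t + 1)) B ∧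
        p • x ∉ multiples (p ^ (t + 2)) B) ∧
      ∀ x ∈ A, x ∈ multiples (p ^ (s + 1)) B → p • x ∈ multiples (p ^ (t + 2)) B := by
  classical
  have hzero (b : B) : b ∈ multiples (p ^ 0) B := mem_multiples.mpr ⟨b, by simp⟩
  obtain ⟨T, ⟨y, hy, hyT⟩, hTmin⟩ : ∃ T, (∃ x ∈ A, p • x ∉ multiples (p ^ T) B) ∧
      ∀ n < T, ∀ x ∈ A, p • x ∈ multiples (p ^ n) B :=
    ⟨Nat.find hex, Nat.find_spec hex, fun n hn => by simpa using Nat.find_min hex hn⟩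
  have hS : ∃ S, ∀ x ∈ A, x ∈ multiples (p ^ S) B → p • x ∈ multiples (p ^ T) B :=
    ⟨T, fun x _ hxT => Submodule.smul_mem _ _ hxT⟩
  obtain ⟨S, hSmax, hSmin⟩ :
      ∃ S, (∀ x ∈ A, x ∈ multiples (p ^ S) B → p • x ∈ multiples (p ^ T) B) ∧
        ∀ n < S, ∃ x ∈ A, x ∈ multiples (p ^ n) B ∧ p • x ∉ multiples (p ^ T) B :=
    ⟨Nat.find hS, Nat.find_spec hS, fun n hn => by simpa using Nat.find_min hS hn⟩
  obtain _ | s := S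
  · exact absurd (hSmax y hy (hzero y)) hyT
  obtain ⟨x, hx, hxs, hxT⟩ := hSmin s s.lt_succ_self
  have hlt : s + 2 < T := by
    by_contra! hTs
    exact hxT (mem_multiples_pow_of_le hTs (hgap x hx s hxs))
  obtain ⟨t, rfl⟩ : ∃ t, T = t + 2 := ⟨T - 2, by omega⟩
  exact ⟨t, s, by omega, ⟨x, hx, hxs, hTmin _ (by omega) x hx, hxT⟩, hSmax⟩

theorem IsGapped.exists_isQBasis (hgap : IsGapped p A) (hA : ∀ a ∈ A, p ^ 2 • a = 0)
    (hex : ∃ n, ∃ x ∈ A, p • x ∉ multiples (p ^ n) B) :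
    ∃ (t s : ℕ) (u w : B), IsQBasis p A t s u w := by
  obtain ⟨t, s, hst, ⟨x, hx, hxs, hpxt, hpxt'⟩, hmax⟩ := hgap.exists_extremal hex
  obtain ⟨u, hu⟩ := mem_multiples.mp hpxt
  have hus : p ^ t • u ∈ multiples (p ^ (s + 1)) B :=
    mem_multiples_pow_of_le hst (smul_mem_multiples _ u)
  obtain ⟨w, hw⟩ := mem_multiples.mp
    (sub_mem hxs (mem_multiples_pow_of_le s.le_succ hus) : x - p ^ t • u ∈ multiples (p ^ s) B)
  refine ⟨t, s, u, w, hst, ?_, ?_, ?_, ?_, fun hws => ?_, hmax⟩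
  · rwa [hw, add_sub_cancel]
  · rw [pow_succ', mul_smul, hu, ← mul_smul, ← sq, hA x hx]
  · rw [pow_succ', mul_smul, hw, smul_sub, ← hu, smul_smul, ← pow_succ', sub_self]
  · rwa [hu]
  · rw [hw, sub_mem_comm_iff, Submodule.sub_mem_iff_right _ hus] at hws
    exact hpxt' (hmax x hx hws)

variable {t s : ℕ} {u w : B}

/-- The linear map from the ambient module of `Q^(t+2)_(s+1)` to `B` with `1 ↦ u` and `1 ↦ w` on
the two cyclic summands. -/
def IsQBasis.lift (h : IsQBasis p A t s u w) :
    (Λ ⧸ Ideal.span {p ^ (t + 2)}) × (Λ ⧸ Ideal.span {p ^ (s + 1)}) →ₗ[Λ] B :=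
  (cyclicLift h.smul_left).coprod (cyclicLift h.smul_right)

theorem IsQBasis.map_eq_mk (h : IsQBasis p A t s u w)
    {f : B →ₗ[Λ] Λ ⧸ Ideal.span {p ^ (t + 2)}} (hf : f ∘ₗ h.lift = LinearMap.fst Λ _ _)
    (r r' : Λ) : f (r • u + r' • w) = Ideal.Quotient.mk _ r :=
  LinearMap.congr_fun hf (Ideal.Quotient.mk _ r, Ideal.Quotient.mk _ r')

variable [IsDomain Λ]

theorem IsQBasis.smul_right_notMem_sup_ker (h : IsQBasis p A t s u w) (hp : Prime p)
    {f : B →ₗ[Λ] Λ ⧸ Ideal.span {p ^ (t + 2)}} (hf : f ∘ₗ h.lift = LinearMap.fst Λ _ _) :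
    p ^ s • w ∉ multiples (p ^ (s + 1)) B ⊔ (A ⊓ LinearMap.ker f) := by
  rw [Submodule.mem_sup]
  rintro ⟨b, hb, a, ⟨ha, hfa⟩, hw⟩
  have hmem : p ^ t • u + p ^ s • w - a ∈ multiples (p ^ (s + 1)) B := by
    rw [← hw, add_sub_assoc, add_sub_cancel_right]
    exact add_mem (mem_multiples_pow_of_le h.lt (smul_mem_multiples _ u)) hb
  obtain ⟨c, hc⟩ := mem_multiples.mp (h.maximal _ (sub_mem h.mem ha) hmem)
  have hfc := congrArg f hc
  have hzero : p ^ (t + 2) • f c = 0 := by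
    obtain ⟨y, hy⟩ := Ideal.Quotient.mk_surjective (f c)
    rw [← hy]
    exact (Ideal.Quotient.eq_zero_iff_dvd _ _).mpr (dvd_mul_right _ y)
  rw [map_smul, map_smul, map_sub, h.map_eq_mk hf, LinearMap.mem_ker.mp hfa, hzero, sub_zero] at hfc
  have hdvd : p ^ (t + 2) ∣ p * p ^ t := (Ideal.Quotient.eq_zero_iff_dvd _ _).mp hfc.symm
  rw [← pow_succ', pow_dvd_pow_iff hp.ne_zero hp.not_isUnit] at hdvd
  omega

variable [IsPrincipalIdealRing Λ]

theorem IsQBasis.dvd_left_of_smul_mem (h : IsQBasis p A t s u w) (hp : Prime p) {r : Λ}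
    (hr : r • u ∈ multiples (p ^ (t + 2)) B) : p ^ (t + 2) ∣ r :=
  dvd_of_smul_mem hp (h.smul_left ▸ zero_mem _) h.left_notMem hr

theorem IsQBasis.smul_right_notMem_sup_span (h : IsQBasis p A t s u w) (hp : Prime p) :
    p ^ s • w ∉ multiples (p ^ (t + 2)) B ⊔ Submodule.span Λ {u} := by
  rw [Submodule.mem_sup]
  rintro ⟨b, hb, _, hu, hw⟩
  obtain ⟨r, rfl⟩ := Submodule.mem_span_singleton.mp hu
  have hdvd : p ^ (t + 1) ∣ r := by
    have hpr : (p * r) • u = -(p • b) := by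
      rw [mul_smul, eq_neg_iff_add_eq_zero, add_comm, ← smul_add, hw, smul_smul, ← pow_succ',
        h.smul_right]
    have hpt : p ^ (t + 2) ∣ p * r :=
      h.dvd_left_of_smul_mem hp (hpr ▸ neg_mem (Submodule.smul_mem _ p hb))
    exact (mul_dvd_mul_iff_left hp.ne_zero).mp (pow_succ' p (t + 1) ▸ hpt)
  have hw' : p ^ s • w ∈ multiples (p ^ (t + 1)) B := by
    rw [← hw]
    exact add_mem (mem_multiples_pow_of_le (by omega) hb)
      (multiples_mono hdvd (smul_mem_multiples r u))
  exact h.right_notMem (mem_multiples_pow_of_le (Nat.succ_le_succ h.lt.le) hw')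

theorem IsQBasis.dvd_left (h : IsQBasis p A t s u w) (hp : Prime p) {r r' : Λ}
    (hr : r • u + r' • w ∈ multiples (p ^ (t + 2)) B) : p ^ (t + 2) ∣ r := by
  have hw : r' • w ∈ multiples (p ^ (t + 2)) B ⊔ Submodule.span Λ {u} :=
    Submodule.mem_sup.mpr ⟨_, hr, _,
      Submodule.smul_mem _ (-r) (Submodule.mem_span_singleton_self u), by rw [neg_smul]; abel⟩
  obtain ⟨c, rfl⟩ := dvd_of_smul_mem hp (h.smul_right ▸ zero_mem _)
    (h.smul_right_notMem_sup_span hp) hw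
  rw [mul_comm, mul_smul, h.smul_right, smul_zero, add_zero] at hr
  exact h.dvd_left_of_smul_mem hp hr

theorem IsQBasis.exists_left (h : IsQBasis p A t s u w) (hp : Prime p) :
    ∃ f : B →ₗ[Λ] Λ ⧸ Ideal.span {p ^ (t + 2)}, f ∘ₗ h.lift = LinearMap.fst Λ _ _ := by
  refine exists_extension (pow_ne_zero _ hp.ne_zero) _ _ ?_
  rintro ⟨y, z⟩ hyz
  obtain ⟨r, rfl⟩ := Ideal.Quotient.mk_surjective y
  obtain ⟨r', rfl⟩ := Ideal.Quotient.mk_surjective z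
  exact (Ideal.Quotient.eq_zero_iff_dvd _ _).mpr (h.dvd_left hp hyz)

theorem IsQBasis.dvd_right (h : IsQBasis p A t s u w) (hp : Prime p)
    {f : B →ₗ[Λ] Λ ⧸ Ideal.span {p ^ (t + 2)}} (hf : f ∘ₗ h.lift = LinearMap.fst Λ _ _)
    {a : B} (ha : a ∈ A ⊓ LinearMap.ker f) {r r' : Λ}
    (hr : a + (r • u + r' • w) ∈ multiples (p ^ (s + 1)) B) : p ^ (s + 1) ∣ r' := by
  have hst := h.lt
  have hdvd : p ^ (s + 1) ∣ r := by
    obtain ⟨y, hy⟩ := mem_multiples.mp (map_mem_multiples f hr)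
    obtain ⟨y, rfl⟩ := Ideal.Quotient.mk_surjective y
    rw [map_add, LinearMap.mem_ker.mp ha.2, zero_add, h.map_eq_mk hf] at hy
    have hdvd : p ^ (t + 2) ∣ p ^ (s + 1) * y - r :=
      Ideal.mem_span_singleton.mp (Ideal.Quotient.mk_eq_mk_iff_sub_mem _ _ |>.mp hy)
    exact (dvd_sub_right (dvd_mul_right _ _)).mp ((pow_dvd_pow p (by omega)).trans hdvd)
  have hw : r' • w ∈ multiples (p ^ (s + 1)) B ⊔ (A ⊓ LinearMap.ker f) :=
    Submodule.mem_sup.mpr ⟨_, sub_mem hr (multiples_mono hdvd (smul_mem_multiples r u)), -a,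
      neg_mem ha, by abel⟩
  exact dvd_of_smul_mem hp (h.smul_right ▸ zero_mem _) (h.smul_right_notMem_sup_ker hp hf) hw

theorem IsQBasis.exists_right (h : IsQBasis p A t s u w) (hp : Prime p)
    {f : B →ₗ[Λ] Λ ⧸ Ideal.span {p ^ (t + 2)}} (hf : f ∘ₗ h.lift = LinearMap.fst Λ _ _) :
    ∃ g : B →ₗ[Λ] Λ ⧸ Ideal.span {p ^ (s + 1)}, g ∘ₗ h.lift = LinearMap.snd Λ _ _ ∧
      A ⊓ LinearMap.ker f ≤ LinearMap.ker g := by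
  obtain ⟨g, hg⟩ := exists_extension (pow_ne_zero (s + 1) hp.ne_zero)
    ((A ⊓ LinearMap.ker f).subtype.coprod h.lift) (LinearMap.snd Λ _ _ ∘ₗ LinearMap.snd Λ _ _) <| by
      rintro ⟨a, y, z⟩ hyz
      obtain ⟨r, rfl⟩ := Ideal.Quotient.mk_surjective y
      obtain ⟨r', rfl⟩ := Ideal.Quotient.mk_surjective z
      exact (Ideal.Quotient.eq_zero_iff_dvd _ _).mpr (h.dvd_right hp hf a.2 hyz)
  refine ⟨g, LinearMap.ext fun d => ?_, fun a ha => ?_⟩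
  · simpa using LinearMap.congr_fun hg (0, d)
  · simpa using LinearMap.congr_fun hg (⟨a, ha⟩, 0)

theorem Indecomposable.iso_qPair (hA : Indecomposable A) (hp : Prime p)
    (hA2 : ∀ a ∈ A, p ^ 2 • a = 0) (h : IsQBasis p A t s u w) :
    Iso A (qPair p (t + 2) (s + 1)) := by
  obtain ⟨f, hf⟩ := h.exists_left hp
  obtain ⟨g, hg, hAg⟩ := h.exists_right hp hf
  have := nontrivial_quotient_pow hp s.succ_ne_zero
  have hfg : f.prod g ∘ₗ h.lift = LinearMap.id := by
    rw [LinearMap.prod_comp, hf, hg, LinearMap.pair_fst_snd]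
  refine hA.iso_of_retract hfg ?_ ?_
  · rw [qPair, Submodule.map_span_le]
    rintro _ rfl
    exact h.mem
  · rintro _ ⟨a, ha, rfl⟩
    obtain ⟨ρ, hρ⟩ := Submodule.mem_span_singleton.mp
      (mem_span_mk_of_smul_eq_zero (y := f a) (pow_ne_zero 2 hp.ne_zero)
        (pow_mul_pow_sub p (Nat.le_add_left 2 t)) (by rw [← map_smul, hA2 a ha, map_zero]))
    have hx : f.prod g (p ^ t • u + p ^ s • w)
        = (Ideal.Quotient.mk _ (p ^ t), Ideal.Quotient.mk _ (p ^ s)) :=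
      LinearMap.congr_fun hfg (Ideal.Quotient.mk _ (p ^ t), Ideal.Quotient.mk _ (p ^ s))
    have hker : a - ρ • (p ^ t • u + p ^ s • w) ∈ A ⊓ LinearMap.ker f := by
      refine ⟨A.sub_mem ha (A.smul_mem ρ h.mem), ?_⟩
      change f (a - ρ • (p ^ t • u + p ^ s • w)) = 0
      rw [map_sub, map_smul, ← hρ, h.map_eq_mk hf, Nat.add_sub_cancel, sub_self]
    have hfga : f.prod g (a - ρ • (p ^ t • u + p ^ s • w)) = 0 := Prod.ext hker.2 (hAg hker)
    rw [map_sub, map_smul, hx, sub_eq_zero] at hfga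
    exact Submodule.mem_span_singleton.mpr ⟨ρ, hfga.symm⟩

end QType

section Classification

variable {Λ : Type*} [CommRing Λ] {B : Type*} [AddCommGroup B] [Module Λ B]

theorem exists_prime_smul_eq_zero [UniqueFactorizationMonoid Λ] {r : Λ} (hr : r ≠ 0) {x : B}
    (hx : x ≠ 0) (hrx : r • x = 0) : ∃ (q : Λ) (y : B), Prime q ∧ y ≠ 0 ∧ q • y = 0 := by
  induction r using UniqueFactorizationMonoid.induction_on_prime generalizing x with
  | h₁ => exact absurd rfl hr
  | h₂ r hu => exact absurd (hu.smul_eq_zero.mp hrx) hx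
  | h₃ r q hr0 hq ih =>
    by_cases h : r • x = 0
    · exact ih hr0 hx h
    · exact ⟨q, r • x, hq, h, by rw [← mul_smul, hrx]⟩

variable [IsDomain Λ] [IsPrincipalIdealRing Λ] {p : Λ} {A : Submodule Λ B}

theorem Indecomposable.exists_iso_picket_two (hA : Indecomposable A) (hp : Prime p)
    (hA2 : ∀ a ∈ A, p ^ 2 • a = 0) (hgap : ¬ IsGapped p A) : ∃ m, Iso A (picket p (m + 2) 2) := by
  simp only [IsGapped, not_forall] at hgap
  obtain ⟨x, hx, m, hxm, hpx⟩ := hgap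
  obtain ⟨c, rfl⟩ := mem_multiples.mp hxm
  refine ⟨m, hA.iso_picket hp (Nat.le_add_left _ _) ?_ ?_ hx hA2⟩
  · rw [← hA2 _ hx, smul_smul, ← pow_add, add_comm 2]
  · rwa [smul_smul, ← pow_succ'] at hpx

variable [Module.Finite Λ B]

theorem Indecomposable.isFreeType_of_isTorsionFree [Module.IsTorsionFree Λ B]
    (hA : Indecomposable (⊥ : Submodule Λ B)) : IsFreeType (⊥ : Submodule Λ B) := by
  have := hA.1
  let b := Module.Free.chooseBasis Λ B
  obtain ⟨i⟩ := b.index_nonempty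
  exact hA.iso_of_retract (i := LinearMap.toSpanSingleton Λ B (b i)) (r := b.coord i)
    (by ext; simp) (by simp) (by simp)

theorem Indecomposable.exists_iso_picket_zero (hA : Indecomposable (⊥ : Submodule Λ B))
    (hp : Prime p) {x : B} (hx : x ≠ 0) (hpx : p • x = 0) :
    ∃ m, Iso (⊥ : Submodule Λ B) (picket p (m + 1) 0) := by
  obtain ⟨m, c, rfl, hmc⟩ := exists_pow_smul_eq_and_notMem hx hpx
  have hc : p ^ (m + 1) • c = 0 := by rw [pow_succ', mul_smul, hpx]
  exact ⟨m, hA.iso_picket hp (Nat.zero_le _) hc hmc hc (by simp)⟩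

theorem Indecomposable.exists_iso_picket_one (hA : Indecomposable A) (hp : Prime p)
    (hA1 : ∀ a ∈ A, p • a = 0) (hA0 : A ≠ ⊥) : ∃ m, Iso A (picket p (m + 1) 1) := by
  obtain ⟨x, hxA, hx⟩ := Submodule.exists_mem_ne_zero_of_ne_bot hA0
  obtain ⟨m, c, rfl, hmc⟩ := exists_pow_smul_eq_and_notMem hx (hA1 x hxA)
  have hc : p ^ (m + 1) • c = 0 := by rw [pow_succ', mul_smul, hA1 _ hxA]
  exact ⟨m, hA.iso_picket hp (Nat.le_add_left _ _) hc hmc hxA (by simpa using hA1)⟩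

theorem Indecomposable.isListed_bot (hp : Prime p) (hA : Indecomposable (⊥ : Submodule Λ B)) :
    IsListed p (⊥ : Submodule Λ B) := by
  by_cases htf : Module.IsTorsionFree Λ B
  · exact .inr (.inr hA.isFreeType_of_isTorsionFree)
  obtain ⟨r, x, hr, hx, hrx⟩ : ∃ (r : Λ) (x : B), r ≠ 0 ∧ x ≠ 0 ∧ r • x = 0 := by
    by_contra! h
    exact htf (.of_smul_eq_zero fun r x hrx => by
      by_contra! hcon
      exact h r x hcon.1 hcon.2 hrx)
  obtain ⟨q, y, hq, hy, hqy⟩ := exists_prime_smul_eq_zero hr hx hrx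
  by_cases hqp : q ∣ p
  · have hpy : p • y = 0 := by
      obtain ⟨s, rfl⟩ := hqp
      rw [mul_comm, mul_smul, hqy, smul_zero]
    obtain ⟨m, hm⟩ := hA.exists_iso_picket_zero hp hy hpy
    exact .inr (.inl (.inl ⟨m + 1, 0, by omega, by omega, by omega, hm⟩))
  · obtain ⟨m, hm⟩ := hA.exists_iso_picket_zero hq hy hqy
    have hbot : picket q (m + 1) 0 = ⊥ :=
      Submodule.span_singleton_eq_bot.mpr
        (Ideal.Quotient.eq_zero_iff_mem.mpr (Ideal.mem_span_singleton_self _))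
    exact .inl ⟨q ^ (m + 1), hq.isPrimePow.pow m.succ_ne_zero,
      (hq.irreducible.coprime_iff_not_dvd.mpr hqp).pow_left, hbot ▸ hm⟩

theorem Indecomposable.isListed (hp : Prime p) (hA : Indecomposable A)
    (hA2 : ∀ a ∈ A, p ^ 2 • a = 0) : IsListed p A := by
  by_cases hA0 : A = ⊥
  · subst hA0
    exact hA.isListed_bot hp
  by_cases hA1 : ∀ a ∈ A, p • a = 0
  · obtain ⟨m, hm⟩ := hA.exists_iso_picket_one hp hA1 hA0
    exact .inr (.inl (.inl ⟨m + 1, 1, by omega, by omega, by omega, hm⟩))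
  by_cases hgap : IsGapped p A
  · push Not at hA1
    obtain ⟨x, hx, hpx⟩ := hA1
    obtain ⟨n, hn⟩ := exists_notMem_multiples hpx (by rw [smul_smul, ← sq, hA2 x hx])
    obtain ⟨t, s, u, w, h⟩ := hgap.exists_isQBasis hA2 ⟨n, x, hx, hn⟩
    have hst := h.lt
    exact .inr (.inl (.inr ⟨t + 2, s + 1, by omega, by omega, hA.iso_qPair hp hA2 h⟩))
  · obtain ⟨m, hm⟩ := hA.exists_iso_picket_two hp hA2 hgap
    exact .inr (.inl (.inl ⟨m + 2, 2, by omega, by omega, le_rfl, hm⟩))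

end Classification

section Indecomposability

variable {Λ : Type*} [CommRing Λ] {B : Type*} [AddCommGroup B] [Module Λ B]

theorem indecomposable_self [IsDomain Λ] (A : Submodule Λ Λ) : Indecomposable A := by
  refine indecomposable_iff_isIdempotentElem.mpr fun e he _ => ?_
  have he1 : IsIdempotentElem (e 1) := by
    rw [IsIdempotentElem, ← smul_eq_mul, ← map_smul, smul_eq_mul, mul_one,
      ← Module.End.mul_apply, he.eq]
  exact (IsIdempotentElem.iff_eq_zero_or_one.mp he1).imp (fun h => LinearMap.ext_ring h)
    fun h => LinearMap.ext_ring h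

theorem apply_eq_zero_or_eq_self_of_isIdempotentElem [IsDomain Λ] {p : Λ} (hp : Prime p) {n : ℕ}
    {x : B} (hx : ∀ c : Λ, c • x = 0 ↔ p ^ n ∣ c) {e : Module.End Λ B} (he : IsIdempotentElem e)
    (hex : e x ∈ Submodule.span Λ {x}) : e x = 0 ∨ e x = x := by
  obtain ⟨r, hr⟩ := Submodule.mem_span_singleton.mp hex
  have hrr : (r * (r - 1)) • x = 0 := by
    rw [mul_sub, mul_one, sub_smul, mul_smul, hr, ← map_smul, hr, ← Module.End.mul_apply, he.eq,
      sub_self]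
  have hdvd := (hx _).mp hrr
  by_cases h : p ∣ r
  · have h1 : ¬ p ∣ r - 1 := fun h1 => hp.not_dvd_one ((dvd_sub_right h).mp h1)
    exact .inl (hr ▸ (hx r).mpr (hp.pow_dvd_of_dvd_mul_right n h1 hdvd))
  · have h1 := (hx _).mpr (hp.pow_dvd_of_dvd_mul_left n h hdvd)
    rw [sub_smul, one_smul, hr, sub_eq_zero] at h1
    exact .inr h1

theorem indecomposable_quotient_pow [IsDomain Λ] {p : Λ} (hp : Prime p) {n : ℕ} (hn : n ≠ 0)
    (A : Submodule Λ (Λ ⧸ Ideal.span {p ^ n})) : Indecomposable A := by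
  have := nontrivial_quotient_pow hp hn
  refine indecomposable_iff_isIdempotentElem.mpr fun e he _ => ?_
  let x := Ideal.Quotient.mk (Ideal.span {p ^ n}) 1
  have hgen (y : Λ ⧸ Ideal.span {p ^ n}) : ∃ c : Λ, c • x = y := by
    obtain ⟨c, rfl⟩ := Ideal.Quotient.mk_surjective y
    exact ⟨c, congrArg _ (mul_one c)⟩
  have hx (c : Λ) : c • x = 0 ↔ p ^ n ∣ c := by
    rw [← Ideal.Quotient.eq_zero_iff_dvd]
    exact Eq.congr_left (congrArg _ (mul_one c))
  refine (apply_eq_zero_or_eq_self_of_isIdempotentElem hp hx he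
    (Submodule.mem_span_singleton.mpr (hgen _))).imp (fun h => ?_) fun h => ?_
  all_goals
    refine LinearMap.ext fun y => ?_
    obtain ⟨c, rfl⟩ := hgen y
    simp [h]

theorem eq_zero_of_isIdempotentElem_of_mem_multiples {p : Λ} {n : ℕ} (hB : ∀ b : B, p ^ n • b = 0)
    {e : Module.End Λ B} (he : IsIdempotentElem e) (hep : ∀ b, e b ∈ multiples p B) : e = 0 := by
  have hpow (k : ℕ) (b : B) : e b ∈ multiples (p ^ k) B := by
    induction k with
    | zero => exact mem_multiples.mpr ⟨e b, by simp⟩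
    | succ k ih =>
      obtain ⟨c, hc⟩ := mem_multiples.mp ih
      rw [← he.eq, Module.End.mul_apply, ← hc, map_smul, pow_succ]
      exact smul_mem_multiples_mul _ (hep c)
  ext b
  obtain ⟨c, hc⟩ := mem_multiples.mp (hpow n b)
  rw [← hc, hB, LinearMap.zero_apply]

theorem exists_apply_mk_eq {I J : Ideal Λ} (e : Module.End Λ ((Λ ⧸ I) × (Λ ⧸ J))) :
    ∃ a b c d : Λ, ∀ x y : Λ, e (Ideal.Quotient.mk I x, Ideal.Quotient.mk J y) =
      (Ideal.Quotient.mk I (a * x + b * y), Ideal.Quotient.mk J (c * x + d * y)) := by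
  obtain ⟨a, ha⟩ := Ideal.Quotient.mk_surjective (e (1, 0)).1
  obtain ⟨c, hc⟩ := Ideal.Quotient.mk_surjective (e (1, 0)).2
  obtain ⟨b, hb⟩ := Ideal.Quotient.mk_surjective (e (0, 1)).1
  obtain ⟨d, hd⟩ := Ideal.Quotient.mk_surjective (e (0, 1)).2
  refine ⟨a, b, c, d, fun x y => ?_⟩
  have hxy : (Ideal.Quotient.mk I x, Ideal.Quotient.mk J y) =
      x • ((1, 0) : (Λ ⧸ I) × (Λ ⧸ J)) + y • ((0, 1) : (Λ ⧸ I) × (Λ ⧸ J)) := by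
    simp [Algebra.smul_def]
  rw [hxy, map_add, map_smul, map_smul]
  ext <;> simp [Algebra.smul_def, ha, hb, hc, hd, mul_comm]

theorem dvd_of_pow_dvd_mul_pow_add_mul_pow [IsDomain Λ] {p : Λ} (hp : Prime p) {s t : ℕ}
    (hst : s < t) {a b c d : Λ} (hb : p ^ (t + 2) ∣ b * p ^ (s + 1))
    (hab : p ^ (t + 2) ∣ a * p ^ t + b * p ^ s) (hcd : p ^ (s + 1) ∣ c * p ^ t + d * p ^ s) :
    p ∣ a ∧ p ∣ b ∧ p ∣ d := by
  have cancel {m n : ℕ} {r : Λ} (hmn : m < n) (h : p ^ n ∣ r * p ^ m) : p ∣ r := by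
    have h' := (pow_dvd_pow p (Nat.succ_le_of_lt hmn)).trans h
    rwa [pow_succ', mul_dvd_mul_iff_right (pow_ne_zero m hp.ne_zero)] at h'
  have hbs : p ^ (t + 1) ∣ b * p ^ s := by
    rwa [pow_succ p (t + 1), pow_succ p s, ← mul_assoc, mul_dvd_mul_iff_right hp.ne_zero] at hb
  have hct : p ^ (s + 1) ∣ c * p ^ t := (pow_dvd_pow p hst).mul_left c
  exact ⟨cancel t.lt_succ_self ((dvd_add_left hbs).mp ((pow_dvd_pow p (by omega)).trans hab)),
    cancel (by omega) hb, cancel s.lt_succ_self ((dvd_add_right hct).mp hcd)⟩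

theorem eq_zero_of_isIdempotentElem_of_apply_eq_zero [IsDomain Λ] {p : Λ} (hp : Prime p)
    {s t : ℕ} (hst : s < t)
    {e : Module.End Λ ((Λ ⧸ Ideal.span {p ^ (t + 2)}) × (Λ ⧸ Ideal.span {p ^ (s + 1)}))}
    (he : IsIdempotentElem e)
    (hex : e (Ideal.Quotient.mk _ (p ^ t), Ideal.Quotient.mk _ (p ^ s)) = 0) : e = 0 := by
  obtain ⟨a, b, c, d, hmat⟩ := exists_apply_mk_eq e
  have hey : e (Ideal.Quotient.mk _ 0, Ideal.Quotient.mk _ (p ^ (s + 1))) = 0 := by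
    rw [Ideal.Quotient.eq_zero_iff_dvd _ _ |>.mpr dvd_rfl, map_zero, Prod.mk_zero_zero, map_zero]
  simp only [hmat, Prod.mk_eq_zero, Ideal.Quotient.eq_zero_iff_dvd, mul_zero, zero_add] at hex hey
  obtain ⟨⟨a, rfl⟩, ⟨b, rfl⟩, ⟨d, rfl⟩⟩ :=
    dvd_of_pow_dvd_mul_pow_add_mul_pow hp hst hey.1 hex.1 hex.2
  have hsmul (r x y : Λ) : r • ((Ideal.Quotient.mk _ x, Ideal.Quotient.mk _ y) :
      (Λ ⧸ Ideal.span {p ^ (t + 2)}) × (Λ ⧸ Ideal.span {p ^ (s + 1)})) =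
      (Ideal.Quotient.mk _ (r * x), Ideal.Quotient.mk _ (r * y)) := rfl
  -- Modulo `p` the matrix of `e` is strictly triangular, so its square vanishes.
  refine eq_zero_of_isIdempotentElem_of_mem_multiples (p := p) (n := t + 2) ?_ he ?_ <;>
    rintro ⟨x, y⟩ <;>
    obtain ⟨x, rfl⟩ := Ideal.Quotient.mk_surjective x <;>
    obtain ⟨y, rfl⟩ := Ideal.Quotient.mk_surjective y
  · rw [hsmul, Prod.mk_eq_zero, Ideal.Quotient.eq_zero_iff_dvd, Ideal.Quotient.eq_zero_iff_dvd]
    exact ⟨dvd_mul_right _ _, (pow_dvd_pow p (by omega)).mul_right y⟩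
  · rw [← he.eq, Module.End.mul_apply, hmat, hmat]
    refine mem_multiples.mpr ⟨(Ideal.Quotient.mk _ (a * (p * a * x + p * b * y) +
      b * (c * x + p * d * y)), Ideal.Quotient.mk _ (c * (a * x + b * y) +
      d * (c * x + p * d * y))), ?_⟩
    rw [hsmul]
    congr 2 <;> ring

theorem indecomposable_qPair [IsDomain Λ] {p : Λ} (hp : Prime p) {s t : ℕ} (hst : s < t) :
    Indecomposable (qPair p (t + 2) (s + 1)) := by
  have := nontrivial_quotient_pow hp (t + 1).succ_ne_zero
  refine indecomposable_iff_isIdempotentElem.mpr fun e he hAe => ?_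
  let x := (Ideal.Quotient.mk (Ideal.span {p ^ (t + 2)}) (p ^ t),
    Ideal.Quotient.mk (Ideal.span {p ^ (s + 1)}) (p ^ s))
  have hx (c : Λ) : c • x = 0 ↔ p ^ 2 ∣ c := by
    have hcx : c • x = (Ideal.Quotient.mk _ (c * p ^ t), Ideal.Quotient.mk _ (c * p ^ s)) := rfl
    rw [hcx, Prod.mk_eq_zero, Ideal.Quotient.eq_zero_iff_dvd, Ideal.Quotient.eq_zero_iff_dvd,
      mul_comm c, mul_comm c, pow_add, pow_succ p s,
      mul_dvd_mul_iff_left (pow_ne_zero _ hp.ne_zero),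
      mul_dvd_mul_iff_left (pow_ne_zero _ hp.ne_zero)]
    exact and_iff_left_of_imp (dvd_of_mul_left_dvd <| sq p ▸ ·)
  refine (apply_eq_zero_or_eq_self_of_isIdempotentElem hp hx he
    (hAe (Submodule.mem_span_singleton_self x))).imp
      (eq_zero_of_isIdempotentElem_of_apply_eq_zero hp hst he) fun h => ?_
  refine (sub_eq_zero.mp (eq_zero_of_isIdempotentElem_of_apply_eq_zero hp hst he.one_sub ?_)).symm
  exact sub_eq_zero.mpr h.symm

theorem IsListed.indecomposable [IsDomain Λ] {p : Λ} (hp : Prime p) {A : Submodule Λ B}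
    (h : IsListed p A) : Indecomposable A := by
  rcases h with ⟨_, hq, -, hA⟩ | (⟨ℓ, m, hℓ, -, -, hA⟩ | ⟨t, s, hs, hst, hA⟩) | hA
  · obtain ⟨r, n, hr, hn, rfl⟩ := hq
    exact hA.indecomposable (indecomposable_quotient_pow hr hn.ne' _)
  · exact hA.indecomposable (indecomposable_quotient_pow hp (Nat.one_le_iff_ne_zero.mp hℓ) _)
  · obtain ⟨s, rfl⟩ := Nat.exists_eq_add_of_le' hs
    obtain ⟨t, rfl⟩ : ∃ t', t = t' + 2 := ⟨t - 2, by omega⟩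
    exact hA.indecomposable (indecomposable_qPair hp (by omega))
  · exact Iso.indecomposable hA (indecomposable_self _)

end Indecomposability

section Independent

variable {α : Type*} [CompleteLattice α] {ι κ : Type*}

theorem iSup_update_of_ne [DecidableEq ι] (f : ι → α) (i : ι) (y : α) :
    ⨆ j ≠ i, Function.update f i y j = ⨆ j ≠ i, f j :=
  iSup_congr fun _ => iSup_congr fun hj => Function.update_of_ne hj ..

variable [IsModularLattice α] {f : ι → α}

theorem iSupIndep_sumElim {g : κ → α} (hf : iSupIndep f) (hg : iSupIndep g)
    (h : Disjoint (⨆ i, f i) (⨆ j, g j)) : iSupIndep (Sum.elim f g) := by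
  rintro (i | j)
  · have hle : ⨆ k, ⨆ (_ : k ≠ Sum.inl i), Sum.elim f g k ≤
        (⨆ k, ⨆ (_ : k ≠ i), f k) ⊔ ⨆ j, g j := by
      simp only [iSup_sum, ne_eq, Sum.inl.injEq, reduceCtorEq, not_false_eq_true, iSup_pos,
        Sum.elim_inl, Sum.elim_inr, le_refl]
    refine ((hf i).disjoint_sup_right_of_disjoint_sup_left (h.mono_left ?_)).mono_right hle
    exact sup_le (le_iSup f i) (iSup₂_le_iSup _ f)
  · have hle : ⨆ k, ⨆ (_ : k ≠ Sum.inr j), Sum.elim f g k ≤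
        (⨆ k, ⨆ (_ : k ≠ j), g k) ⊔ ⨆ i, f i := by
      simp only [iSup_sum, ne_eq, Sum.inr.injEq, reduceCtorEq, not_false_eq_true, iSup_pos,
        Sum.elim_inl, Sum.elim_inr, sup_comm, le_refl]
    refine ((hg j).disjoint_sup_right_of_disjoint_sup_left (h.symm.mono_left ?_)).mono_right hle
    exact sup_le (le_iSup g j) (iSup₂_le_iSup _ g)

theorem iSupIndep_update [DecidableEq ι] (hf : iSupIndep f) {i : ι} {y : α}
    (hy : Disjoint y (⨆ j ≠ i, f j)) : iSupIndep (Function.update f i y) := by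
  intro k
  obtain rfl | hk := eq_or_ne k i
  · rwa [Function.update_self, iSup_update_of_ne]
  rw [Function.update_of_ne hk]
  let z := ⨆ j ≠ k, ⨆ (_ : j ≠ i), f j
  have hsup : f k ⊔ z ≤ ⨆ j ≠ i, f j :=
    sup_le (le_iSup₂_of_le k hk le_rfl)
      (iSup₂_le fun j _ => iSup_le fun hj => le_iSup₂_of_le j hj le_rfl)
  have hz : Disjoint (f k) z :=
    (hf k).mono_right (iSup₂_mono fun _ _ => iSup_le fun _ => le_rfl)
  refine (hz.disjoint_sup_right_of_disjoint_sup_left (hy.symm.mono_left hsup)).mono_right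
    (iSup₂_le fun j hj => ?_)
  obtain rfl | hji := eq_or_ne j i
  · rw [Function.update_self]
    exact le_sup_right
  · rw [Function.update_of_ne hji]
    exact le_sup_of_le_left (le_iSup₂_of_le j hj (le_iSup (fun _ => f j) hji))

end Independent

section Existence

variable {Λ : Type*} [CommRing Λ] {B : Type*} [AddCommGroup B] [Module Λ B]
  {A U V W : Submodule Λ B}

theorem exists_split_of_not_indecomposable (hW : W ≠ ⊥) (h : ¬ Indecomposable (summand A W)) :
    ∃ U V : Submodule Λ B, U ≠ ⊥ ∧ V ≠ ⊥ ∧ Disjoint U V ∧ U ⊔ V = W ∧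
      A ⊓ U ⊔ A ⊓ V = A ⊓ W := by
  have hinj := W.injective_subtype
  have hbot {X : Submodule Λ W} (hX : X ≠ ⊥) : X.map W.subtype ≠ ⊥ :=
    (Submodule.map_injective_of_injective hinj).ne_iff' (Submodule.map_bot _) |>.mpr hX
  have hinf (X : Submodule Λ W) : A ⊓ X.map W.subtype = (summand A W ⊓ X).map W.subtype := by
    rw [inf_comm, Submodule.map_inf_eq_map_inf_comap, inf_comm]
    rfl
  have hAW : (summand A W).map W.subtype = A ⊓ W := by
    rw [summand, Submodule.submoduleOf, Submodule.map_comap_subtype, inf_comm]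
  simp only [Indecomposable, Submodule.nontrivial_iff_ne_bot.mpr hW, true_and, not_forall,
    not_or] at h
  obtain ⟨U, V, hUV, hA, hU, hV⟩ := h
  refine ⟨U.map W.subtype, V.map W.subtype, hbot hU, hbot hV,
    (Submodule.disjoint_map hinj hUV.disjoint), ?_, ?_⟩
  · rw [← Submodule.map_sup, hUV.sup_eq_top, Submodule.map_subtype_top]
  · rw [hinf, hinf, ← Submodule.map_sup, hA, hAW]

/-- The summand `(W; A ∩ W)` is a finite direct sum of indecomposable pairs, all of them given by
submodules of the module that contains `W`. -/
def HasDecomposition (A W : Submodule Λ B) : Prop :=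
  ∃ (k : ℕ) (N : Fin k → Submodule Λ B), (∀ i, Indecomposable (summand A (N i))) ∧
    iSupIndep N ∧ ⨆ i, N i = W ∧ ⨆ i, A ⊓ N i = A ⊓ W

theorem HasDecomposition.sup (hU : HasDecomposition A U) (hV : HasDecomposition A V)
    (hUV : Disjoint U V) (hA : A ⊓ U ⊔ A ⊓ V = A ⊓ (U ⊔ V)) : HasDecomposition A (U ⊔ V) := by
  obtain ⟨k, N, hN, hNi, rfl, hNA⟩ := hU
  obtain ⟨l, M, hM, hMi, rfl, hMA⟩ := hV
  let e := (finSumFinEquiv (m := k) (n := l)).symm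
  refine ⟨k + l, Sum.elim N M ∘ e, fun i => ?_,
    (iSupIndep_sumElim hNi hMi hUV).comp e.injective, ?_, ?_⟩
  · exact Sum.rec (motive := fun x => Indecomposable (summand A (Sum.elim N M x))) hN hM (e i)
  · exact (e.iSup_comp (g := Sum.elim N M)).trans iSup_sum
  · rw [← hA, ← hNA, ← hMA]
    exact (e.iSup_comp (g := fun j => A ⊓ Sum.elim N M j)).trans iSup_sum

/-- The ascending chain condition is applied to a module `W'` disjoint from `W`: it can be enlarged
by either half of a splitting of `W` when passing to the other half. -/
theorem hasDecomposition_of_disjoint [IsNoetherian Λ B] (A W' : Submodule Λ B) :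
    ∀ W, Disjoint W W' → HasDecomposition A W := by
  induction W' using WellFoundedGT.induction with
  | ind W' ih =>
  intro W hW
  by_cases hbot : W = ⊥
  · exact ⟨0, fun _ => ⊥, fun i => i.elim0, fun i => i.elim0, by simp [hbot], by simp [hbot]⟩
  by_cases hind : Indecomposable (summand A W)
  · exact ⟨1, fun _ => W, fun _ => hind, iSupIndep_subsingleton _, by simp, by simp⟩
  obtain ⟨U, V, hU, hV, hUV, rfl, hA⟩ := exists_split_of_not_indecomposable hbot hind
  have hlt {X : Submodule Λ B} (hX : X ≠ ⊥) (hXW : X ≤ U ⊔ V) : W' < X ⊔ W' :=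
    right_lt_sup.mpr fun hle => hX ((hW.mono_left hXW).eq_bot_of_le hle)
  exact (ih _ (hlt hV le_sup_right) U
      (hUV.disjoint_sup_right_of_disjoint_sup_left hW)).sup
    (ih _ (hlt hU le_sup_left) V
      (hUV.symm.disjoint_sup_right_of_disjoint_sup_left (sup_comm U V ▸ hW))) hUV hA

theorem exists_isDirectSum_indecomposable [IsNoetherian Λ B] (A : Submodule Λ B) :
    ∃ (k : ℕ) (N : Fin k → Submodule Λ B), IsDirectSum A N ∧
      ∀ i, Indecomposable (summand A (N i)) := by
  obtain ⟨k, N, hN, hi, hs, hA⟩ := hasDecomposition_of_disjoint A ⊥ ⊤ disjoint_bot_right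
  exact ⟨k, N, ⟨hi, hs, hA.trans (inf_top_eq A)⟩, hN⟩

end Existence

section Projections

variable {Λ : Type*} [CommRing Λ] {B : Type*} [AddCommGroup B] [Module Λ B] {ι : Type*}
  {A : Submodule Λ B} {N : ι → Submodule Λ B}

theorem IsDirectSum.isCompl (h : IsDirectSum A N) (i : ι) : IsCompl (N i) (⨆ j ≠ i, N j) :=
  ⟨h.indep i, codisjoint_iff.mpr (by rw [← iSup_split_single, h.iSup_eq_top])⟩

/-- The projection of `B` onto the summand `N i` of a decomposition of `(B; A)`. -/
noncomputable def IsDirectSum.proj (h : IsDirectSum A N) (i : ι) : B →ₗ[Λ] N i :=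
  (N i).projectionOnto _ (h.isCompl i)

namespace IsDirectSum

theorem proj_coe (h : IsDirectSum A N) (i : ι) (x : N i) : h.proj i x = x :=
  Submodule.projectionOnto_apply_left _ x

theorem ker_proj (h : IsDirectSum A N) (i : ι) : LinearMap.ker (h.proj i) = ⨆ j ≠ i, N j :=
  Submodule.ker_projectionOnto _

theorem proj_eq_zero (h : IsDirectSum A N) {i j : ι} (hij : j ≠ i) {b : B} (hb : b ∈ N j) :
    h.proj i b = 0 := by
  rw [← LinearMap.mem_ker, h.ker_proj]
  exact Submodule.mem_iSup_of_mem j (Submodule.mem_iSup_of_mem hij hb)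

theorem map_proj_le (h : IsDirectSum A N) (i : ι) : A.map (h.proj i) ≤ summand A (N i) := by
  rw [Submodule.map_le_iff_le_comap]
  conv_lhs => rw [← h.iSup_inf_eq]
  refine iSup_le fun j b ⟨hbA, hbN⟩ => ?_
  obtain rfl | hij := eq_or_ne j i
  · rw [Submodule.mem_comap, h.proj_coe j ⟨b, hbN⟩]
    exact hbA
  · simp [h.proj_eq_zero hij hbN]

theorem sum_proj [Fintype ι] (h : IsDirectSum A N) (b : B) : ∑ i, (h.proj i b : B) = b := by
  suffices ⊤ ≤ LinearMap.eqLocus (∑ i, (N i).subtype ∘ₗ h.proj i) LinearMap.id by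
    simpa using this (Submodule.mem_top (x := b))
  rw [← h.iSup_eq_top]
  refine iSup_le fun j x hx => ?_
  simp only [LinearMap.mem_eqLocus, LinearMap.sum_apply, LinearMap.comp_apply,
    Submodule.subtype_apply, LinearMap.id_apply]
  rw [Fintype.sum_eq_single j, h.proj_coe j ⟨x, hx⟩]
  intro i hij
  rw [h.proj_eq_zero hij.symm hx, ZeroMemClass.coe_zero]

theorem mem_iSup_inf_of_mem_ker_proj [Finite ι] (h : IsDirectSum A N) {i : ι} {a : B}
    (ha : a ∈ A) (hai : a ∈ LinearMap.ker (h.proj i)) : a ∈ ⨆ j ≠ i, A ⊓ N j := by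
  cases nonempty_fintype ι
  rw [← h.sum_proj a]
  refine Submodule.sum_mem _ fun j _ => ?_
  obtain rfl | hj := eq_or_ne j i
  · rw [LinearMap.mem_ker.mp hai]
    exact zero_mem _
  · exact Submodule.mem_iSup_of_mem j (Submodule.mem_iSup_of_mem hj
      ⟨h.map_proj_le j (Submodule.mem_map_of_mem ha), (h.proj j a).2⟩)

theorem update [Finite ι] [DecidableEq ι] (h : IsDirectSum A N) {i : ι} {Y : Submodule Λ B}
    (f : B →ₗ[Λ] Y) (hf : ∀ y : Y, f y = y) (hker : LinearMap.ker f = LinearMap.ker (h.proj i))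
    (hA : A.map f ≤ summand A Y) : IsDirectSum A (Function.update N i Y) := by
  have hcompl : IsCompl Y (⨆ j ≠ i, N j) := by
    rw [← h.ker_proj, ← hker]
    exact LinearMap.isCompl_of_proj hf
  refine ⟨iSupIndep_update h.indep hcompl.disjoint, ?_,
    le_antisymm (iSup_le fun j => inf_le_left) fun a ha => ?_⟩
  · rw [iSup_split_single _ i, Function.update_self, iSup_update_of_ne, hcompl.sup_eq_top]
  · have hfa : (f a : B) ∈ A := hA (Submodule.mem_map_of_mem ha)
    have hafa : a - f a ∈ ⨆ j ≠ i, A ⊓ N j :=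
      h.mem_iSup_inf_of_mem_ker_proj (A.sub_mem ha hfa) (by
        rw [← hker, LinearMap.mem_ker, map_sub, hf, sub_self])
    rw [iSup_split_single _ i, Function.update_self, ← add_sub_cancel (f a : B) a]
    refine Submodule.add_mem_sup ⟨hfa, (f a).2⟩ ?_
    rwa [iSup_congr fun j => iSup_congr fun hj : j ≠ i => by rw [Function.update_of_ne hj]]

end IsDirectSum

end Projections

section Endomorphisms

theorem isLocalRing_of_isNilpotent_or_isUnit {R : Type*} [Ring R] [Nontrivial R]
    (h : ∀ a : R, IsNilpotent a ∨ IsUnit a) : IsLocalRing R :=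
  .of_isUnit_or_isUnit_one_sub_self fun a => (h a).symm.imp_right IsNilpotent.isUnit_one_sub

variable {Λ : Type*} [CommRing Λ] {B : Type*} [AddCommGroup B] [Module Λ B] {A : Submodule Λ B}

/-- The endomorphism ring of the pair `(B; A)`. -/
def endRing (A : Submodule Λ B) : Subring (Module.End Λ B) where
  carrier := {f | A ≤ A.comap f}
  mul_mem' hf hg _ ha := hf (hg ha)
  one_mem' _ ha := ha
  add_mem' hf hg _ ha := A.add_mem (hf ha) (hg ha)
  zero_mem' _ _ := A.zero_mem
  neg_mem' hf _ ha := A.neg_mem (hf ha)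

theorem mem_endRing {f : Module.End Λ B} : f ∈ endRing A ↔ A ≤ A.comap f :=
  Iff.rfl

theorem isUnit_endRing_of_injective [IsArtinian Λ B] {f : endRing A}
    (hf : Function.Injective f.1) : IsUnit f := by
  obtain ⟨f, hfA⟩ := f
  have hsurj : Function.Surjective (f.restrict hfA) :=
    IsArtinian.surjective_of_injective_endomorphism _ fun a b hab =>
      Subtype.ext (hf (congrArg Subtype.val hab))
  let e := LinearEquiv.ofBijective f (IsArtinian.bijective_of_injective_endomorphism f hf)
  have he : (e.symm : Module.End Λ B) ∈ endRing A := by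
    intro a ha
    obtain ⟨b, hb⟩ := hsurj ⟨a, ha⟩
    have hba : e.symm a = b := e.symm_apply_eq.mpr (congrArg Subtype.val hb).symm
    rw [Submodule.mem_comap, LinearEquiv.coe_coe, hba]
    exact b.2
  exact ⟨⟨⟨f, hfA⟩, ⟨e.symm, he⟩, Subtype.ext (LinearMap.ext e.apply_symm_apply),
    Subtype.ext (LinearMap.ext e.symm_apply_apply)⟩, rfl⟩

theorem exists_isCompl_ker_range_pow [IsNoetherian Λ B] [IsArtinian Λ B] {f : Module.End Λ B}
    (hf : f ∈ endRing A) : ∃ n ≠ 0, IsCompl (LinearMap.ker (f ^ n)) (LinearMap.range (f ^ n)) ∧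
      A ⊓ LinearMap.ker (f ^ n) ⊔ A ⊓ LinearMap.range (f ^ n) = A := by
  have hfA : ∀ a ∈ A, f a ∈ A := hf
  obtain ⟨n, hn, hAn, hn0⟩ := (f.eventually_isCompl_ker_pow_range_pow.and
    ((f.restrict hfA).eventually_isCompl_ker_pow_range_pow.and
      (Filter.eventually_ne_atTop 0))).exists
  refine ⟨n, hn0, hn, le_antisymm (sup_le inf_le_left inf_le_left) ?_⟩
  rw [Module.End.pow_restrict, LinearMap.ker_restrict, LinearMap.range_restrict] at hAn
  calc A = (⊤ : Submodule Λ A).map A.subtype := (Submodule.map_subtype_top A).symm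
    _ = A ⊓ LinearMap.ker (f ^ n) ⊔ A ⊓ A.map (f ^ n) := by
      rw [← hAn.sup_eq_top, Submodule.map_sup, Submodule.map_comap_subtype,
        Submodule.map_comap_subtype]
    _ ≤ _ := sup_le_sup_left (inf_le_inf_left A LinearMap.map_le_range) _

theorem Indecomposable.isNilpotent_or_isUnit [IsNoetherian Λ B] [IsArtinian Λ B]
    (hA : Indecomposable A) (f : endRing A) : IsNilpotent f ∨ IsUnit f := by
  obtain ⟨n, hn0, hn, hsup⟩ := exists_isCompl_ker_range_pow f.2
  refine (hA.2 _ _ hn hsup).symm.imp (fun hrange => ⟨n, ?_⟩) fun hker => ?_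
  · exact Subtype.ext (LinearMap.range_eq_bot.mp hrange)
  · exact (isUnit_pow_iff hn0).mp (isUnit_endRing_of_injective (LinearMap.ker_eq_bot.mp hker))

theorem Indecomposable.isLocalRing_endRing [IsNoetherian Λ B] [IsArtinian Λ B]
    (hA : Indecomposable A) : IsLocalRing (endRing A) :=
  have := hA.1
  isLocalRing_of_isNilpotent_or_isUnit hA.isNilpotent_or_isUnit

end Endomorphisms

section Exchange

variable {Λ : Type*} [CommRing Λ] {B : Type*} [AddCommGroup B] [Module Λ B]
  {ι κ : Type*} [Finite κ] {A : Submodule Λ B} {N : ι → Submodule Λ B}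
  {N' : κ → Submodule Λ B}

theorem map_summand_le {D : Type*} [AddCommGroup D] [Module Λ D] (A W : Submodule Λ B)
    (f : B →ₗ[Λ] D) : (summand A W).map (f ∘ₗ W.subtype) ≤ A.map f := by
  rw [Submodule.map_comp]
  exact Submodule.map_mono (Submodule.map_comap_le _ _)

namespace IsDirectSum

theorem exists_splitting (hN : IsDirectSum A N) (hN' : IsDirectSum A N') (i : ι)
    [IsNoetherian Λ (N i)] [IsArtinian Λ (N i)] (hi : Indecomposable (summand A (N i))) :
    ∃ (j : κ) (ρ : B →ₗ[Λ] N i), LinearMap.ker ρ = LinearMap.ker (hN.proj i) ∧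
      A.map ρ ≤ summand A (N i) ∧
      (ρ ∘ₗ (N' j).subtype) ∘ₗ hN'.proj j ∘ₗ (N i).subtype = LinearMap.id := by
  cases nonempty_fintype κ
  let α (j : κ) : N i →ₗ[Λ] N' j := hN'.proj j ∘ₗ (N i).subtype
  let β (j : κ) : N' j →ₗ[Λ] N i := hN.proj i ∘ₗ (N' j).subtype
  have hβα (j : κ) : β j ∘ₗ α j ∈ endRing (summand A (N i)) := by
    rw [mem_endRing, ← Submodule.map_le_iff_le_comap, Submodule.map_comp]
    exact (Submodule.map_mono ((map_summand_le ..).trans (hN'.map_proj_le j))).trans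
      ((map_summand_le ..).trans (hN.map_proj_le i))
  have hsum : ∑ j, (⟨β j ∘ₗ α j, hβα j⟩ : endRing (summand A (N i))) = 1 := by
    refine Subtype.ext (LinearMap.ext fun x => ?_)
    calc _ = hN.proj i (∑ j, (hN'.proj j x : B)) := by simp [α, β]
      _ = x := by rw [hN'.sum_proj, hN.proj_coe]
  have := hi.isLocalRing_endRing
  obtain ⟨j, -, hj⟩ := IsLocalRing.exists_of_isUnit_sum (hsum ▸ isUnit_one)
  obtain ⟨u, hu⟩ := hj
  refine ⟨j, u⁻¹.val.val ∘ₗ hN.proj i, ?_, ?_, congrArg Subtype.val (hu ▸ u.inv_mul)⟩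
  · exact LinearMap.ker_comp_of_ker_eq_bot _
      (LinearMap.ker_eq_bot_of_inverse (congrArg Subtype.val u.mul_inv))
  · rw [Submodule.map_comp, Submodule.map_le_iff_le_comap]
    exact (hN.map_proj_le i).trans u⁻¹.val.2

variable [Finite ι]

theorem exchange [DecidableEq ι] (hN : IsDirectSum A N) (hN' : IsDirectSum A N')
    (hN'ind : ∀ j, Indecomposable (summand A (N' j))) (i : ι)
    [IsNoetherian Λ (N i)] [IsArtinian Λ (N i)] (hi : Indecomposable (summand A (N i))) :
    ∃ j, Iso (summand A (N i)) (summand A (N' j)) ∧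
      IsDirectSum A (Function.update N i (N' j)) := by
  obtain ⟨j, ρ, hker, hρA, hρα⟩ := hN.exists_splitting hN' i hi
  let α : N i →ₗ[Λ] N' j := hN'.proj j ∘ₗ (N i).subtype
  have hαA : (summand A (N i)).map α ≤ summand A (N' j) :=
    (map_summand_le ..).trans (hN'.map_proj_le j)
  have hβA : (summand A (N' j)).map (ρ ∘ₗ (N' j).subtype) ≤ summand A (N i) :=
    (map_summand_le ..).trans hρA
  have := hi.1
  have hαρ := (hN'ind j).comp_eq_id_of_retract hρα hαA hβA
  refine ⟨j, ((hN'ind j).iso_of_retract hρα hαA hβA).symm,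
    hN.update (α ∘ₗ ρ) (LinearMap.congr_fun hαρ) ?_ ?_⟩
  · rw [LinearMap.ker_comp_of_ker_eq_bot _ (LinearMap.ker_eq_bot_of_inverse hρα), hker]
  · rw [Submodule.map_comp]
    exact (Submodule.map_mono hρA).trans hαA

theorem exists_exchange [IsNoetherian Λ B] (hN : IsDirectSum A N)
    (hNind : ∀ i, Indecomposable (summand A (N i))) (hN' : IsDirectSum A N')
    (hN'ind : ∀ j, Indecomposable (summand A (N' j))) (s : Finset ι)
    (hs : ∀ i ∈ s, IsArtinian Λ (N i)) :
    ∃ M : ι → Submodule Λ B, IsDirectSum A M ∧ (∀ i ∉ s, M i = N i) ∧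
      ∀ i ∈ s, ∃ j, M i = N' j ∧ Iso (summand A (N i)) (summand A (N' j)) := by
  classical
  induction s using Finset.induction_on with
  | empty => exact ⟨N, hN, fun _ _ => rfl, by simp⟩
  | insert i s hi ih =>
    obtain ⟨M, hM, hMN, hMN'⟩ := ih fun k hk => hs k (Finset.mem_insert_of_mem hk)
    have := hs i (Finset.mem_insert_self i s)
    rw [← hMN i hi] at this
    obtain ⟨j, hj, hMj⟩ := hM.exchange hN' hN'ind i (by rw [hMN i hi]; exact hNind i)
    rw [hMN i hi] at hj
    refine ⟨_, hMj, fun k hk => ?_, fun k hk => ?_⟩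
    · rw [Finset.mem_insert, not_or] at hk
      rw [Function.update_of_ne hk.1, hMN k hk.2]
    · obtain rfl | hki := eq_or_ne k i
      · exact ⟨j, Function.update_self .., hj⟩
      · rw [Function.update_of_ne hki]
        exact hMN' k (Finset.mem_of_mem_insert_of_ne hk hki)

theorem exists_injective [IsNoetherian Λ B] (hN : IsDirectSum A N)
    (hNind : ∀ i, Indecomposable (summand A (N i))) (hN' : IsDirectSum A N')
    (hN'ind : ∀ j, Indecomposable (summand A (N' j))) (P : ι → Prop)
    (hP : ∀ i, P i → IsArtinian Λ (N i)) :
    ∃ σ : {i // P i} → κ, Function.Injective σ ∧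
      ∀ i : {i // P i}, Iso (summand A (N i)) (summand A (N' (σ i))) := by
  classical
  cases nonempty_fintype ι
  obtain ⟨M, hM, -, hMN'⟩ := hN.exists_exchange hNind hN' hN'ind (Finset.univ.filter P) (by simpa)
  choose σ hσM hσ using fun i : {i // P i} => hMN' i (by simpa using i.2)
  have hne (i : {i // P i}) : M i ≠ ⊥ := by
    rw [hσM]
    exact Submodule.nontrivial_iff_ne_bot.mp (hN'ind (σ i)).1
  refine ⟨σ, fun i k hik => Subtype.ext (hM.indep.injOn (hne i) (hne k) ?_), hσ⟩
  rw [hσM, hσM, hik]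

end IsDirectSum

end Exchange

section Torsion

variable {Λ : Type*} [CommRing Λ] {D : Type*} [AddCommGroup D] [Module Λ D]

theorem isArtinian_of_isTorsion [IsNoetherianRing Λ] [Ring.KrullDimLE 1 Λ] [Module.Finite Λ D]
    (hD : Module.IsTorsion Λ D) : IsArtinian Λ D := by
  obtain ⟨r, hrD, hr⟩ := Submodule.annihilator_top_inter_nonZeroDivisors hD
  have : IsArtinianRing (Λ ⧸ Ideal.span {r}) :=
    isArtinian_of_tower Λ (isFiniteLength_iff_isNoetherian_isArtinian.mp
      (isFiniteLength_quotient_span_singleton Λ hr)).2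
  have hDr : Module.IsTorsionBySet Λ D (Ideal.span {r} : Ideal Λ) := by
    rw [Module.isTorsionBySet_span_singleton_iff]
    exact fun x => Submodule.mem_annihilator.mp hrD x trivial
  let := hDr.module
  have := hDr.isScalarTower (S := Λ)
  have := Module.Finite.of_restrictScalars_finite Λ (Λ ⧸ Ideal.span {r}) D
  exact isArtinian_of_surjective_algebraMap (Ideal.Quotient.mk_surjective (I := .span {r}))

theorem isTorsion_of_equiv [IsDomain Λ] {F : Type*} [AddCommGroup F] [Module Λ F] (e : D ≃ₗ[Λ] F)
    {a : Λ} (ha : a ≠ 0) (h : Module.IsTorsionBy Λ F a) : Module.IsTorsion Λ D := fun {x} =>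
  ⟨⟨a, mem_nonZeroDivisors_of_ne_zero ha⟩, e.injective <| by
    rw [Submonoid.mk_smul, map_smul, h, map_zero]⟩

theorem isTorsionBy_quotient_of_dvd {a b : Λ} (hab : a ∣ b) :
    Module.IsTorsionBy Λ (Λ ⧸ Ideal.span {a}) b :=
  (Module.isTorsionBy_quotient_iff _ _).mpr fun x =>
    Ideal.mem_span_singleton.mpr (hab.mul_right x)

theorem IsListed.isFreeType_or_isTorsion [IsDomain Λ] {p : Λ} (hp : p ≠ 0) {C : Submodule Λ D}
    (hC : IsListed p C) : IsFreeType C ∨ Module.IsTorsion Λ D := by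
  rcases hC with ⟨q, hq, -, e, -⟩ | (⟨ℓ, m, -, -, -, e, -⟩ | ⟨t, s, -, hst, e, -⟩) | hfree
  · exact .inr (isTorsion_of_equiv e hq.ne_zero (isTorsionBy_quotient_of_dvd dvd_rfl))
  · exact .inr (isTorsion_of_equiv e (pow_ne_zero ℓ hp) (isTorsionBy_quotient_of_dvd dvd_rfl))
  · have ht : Module.IsTorsionBy Λ (Λ ⧸ Ideal.span {p ^ t}) (p ^ t) :=
      isTorsionBy_quotient_of_dvd dvd_rfl
    have hs : Module.IsTorsionBy Λ (Λ ⧸ Ideal.span {p ^ s}) (p ^ t) :=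
      isTorsionBy_quotient_of_dvd (pow_dvd_pow p (by omega))
    exact .inr (isTorsion_of_equiv e (pow_ne_zero t hp) fun x => Prod.ext (@ht x.1) (@hs x.2))
  · exact .inl hfree

theorem rank_sup_of_supIndep [IsDomain Λ] {ι : Type*} {N : ι → Submodule Λ D} {s : Finset ι}
    (hN : s.SupIndep N) :
    Module.rank Λ (s.sup N : Submodule Λ D) = ∑ i ∈ s, Module.rank Λ (N i) := by
  classical
  induction s using Finset.induction_on with
  | empty => exact rank_bot Λ D
  | insert i s hi ih =>
    have hdisj := hN (Finset.subset_insert i s) (Finset.mem_insert_self i s) hi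
    rw [Finset.sup_insert, Finset.sum_insert hi, ← ih (hN.subset (Finset.subset_insert i s)),
      ← Submodule.rank_sup_add_rank_inf_eq, hdisj.eq_bot, rank_bot, add_zero]

end Torsion

section Matching

theorem exists_equiv_of_subtype {ι κ : Type*} {P : ι → Prop} {Q : κ → Prop} {r : ι → κ → Prop}
    (e : {i // P i} ≃ {j // Q j}) (e' : {i // ¬ P i} ≃ {j // ¬ Q j})
    (he : ∀ i : {i // P i}, r i (e i)) (he' : ∀ i : {i // ¬ P i}, r i (e' i)) :
    ∃ σ : ι ≃ κ, ∀ i, r i (σ i) := by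
  classical
  refine ⟨(Equiv.sumCompl P).symm.trans ((e.sumCongr e').trans (Equiv.sumCompl Q)), fun i => ?_⟩
  obtain ⟨i | i, rfl⟩ := (Equiv.sumCompl P).surjective i
  · simpa using he i
  · simpa using he' i

end Matching

section Uniqueness

variable {Λ : Type*} [CommRing Λ] [IsDomain Λ] {B : Type*} [AddCommGroup B] [Module Λ B]
  {ι κ : Type*} [Finite ι] [Finite κ] {A : Submodule Λ B} {N : ι → Submodule Λ B}
  {N' : κ → Submodule Λ B}

namespace IsDirectSum

theorem rank_eq_card_isFreeType (hN : IsDirectSum A N)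
    (h : ∀ i, IsFreeType (summand A (N i)) ∨ Module.IsTorsion Λ (N i)) :
    Module.rank Λ B = Nat.card {i // IsFreeType (summand A (N i))} := by
  classical
  cases nonempty_fintype ι
  have hrank (i : ι) : Module.rank Λ (N i) = if IsFreeType (summand A (N i)) then 1 else 0 := by
    split_ifs with hi
    · obtain ⟨e, -⟩ := hi
      rw [Module.rank_eq_one_iff_finrank_eq_one, e.finrank_eq, Module.finrank_self]
    · exact ((h i).resolve_left hi).rank_eq_zero
  calc Module.rank Λ B = Module.rank Λ (Finset.univ.sup N : Submodule Λ B) := by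
        rw [Finset.sup_univ_eq_iSup, hN.iSup_eq_top, rank_top]
    _ = ∑ i, if IsFreeType (summand A (N i)) then 1 else 0 := by
        rw [rank_sup_of_supIndep (hN.indep.supIndep' _), Finset.sum_congr rfl fun i _ => hrank i]
    _ = Nat.card {i // IsFreeType (summand A (N i))} := by
        rw [Finset.sum_boole, Nat.card_eq_fintype_card, Fintype.card_subtype]

theorem exists_equiv_isFreeType (hN : IsDirectSum A N) (hN' : IsDirectSum A N')
    (h : ∀ i, IsFreeType (summand A (N i)) ∨ Module.IsTorsion Λ (N i))
    (h' : ∀ j, IsFreeType (summand A (N' j)) ∨ Module.IsTorsion Λ (N' j)) :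
    Nonempty ({i // IsFreeType (summand A (N i))} ≃ {j // IsFreeType (summand A (N' j))}) := by
  have hcard := (hN.rank_eq_card_isFreeType h).symm.trans (hN'.rank_eq_card_isFreeType h')
  exact Finite.card_eq.mp (Nat.cast_injective hcard)

/-- The Krull–Remak–Schmidt argument requires local endomorphism rings, hence only matches the
torsion summands; the free ones are matched by counting. -/
theorem exists_equiv [IsNoetherianRing Λ] [Ring.KrullDimLE 1 Λ] [Module.Finite Λ B]
    (hN : IsDirectSum A N) (hNind : ∀ i, Indecomposable (summand A (N i)))
    (hN' : IsDirectSum A N') (hN'ind : ∀ j, Indecomposable (summand A (N' j)))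
    (h : ∀ W : Submodule Λ B, Indecomposable (summand A W) →
      IsFreeType (summand A W) ∨ Module.IsTorsion Λ W) :
    ∃ σ : ι ≃ κ, ∀ i, Iso (summand A (N i)) (summand A (N' (σ i))) := by
  have hart (W : Submodule Λ B) (hW : Indecomposable (summand A W))
      (hfree : ¬ IsFreeType (summand A W)) : IsArtinian Λ W :=
    isArtinian_of_isTorsion ((h W hW).resolve_left hfree)
  obtain ⟨σ, hσ, hσN⟩ := hN.exists_injective hNind hN' hN'ind _ fun i => hart _ (hNind i)
  obtain ⟨τ, hτ, hτN⟩ := hN'.exists_injective hN'ind hN hNind _ fun j => hart _ (hN'ind j)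
  obtain ⟨e⟩ := hN.exists_equiv_isFreeType hN' (fun i => h _ (hNind i)) fun j => h _ (hN'ind j)
  let σ' (i : {i // ¬ IsFreeType (summand A (N i))}) : {j // ¬ IsFreeType (summand A (N' j))} :=
    ⟨σ i, fun hfree => i.2 ((hσN i).trans hfree)⟩
  let τ' (j : {j // ¬ IsFreeType (summand A (N' j))}) : {i // ¬ IsFreeType (summand A (N i))} :=
    ⟨τ j, fun hfree => j.2 ((hτN j).trans hfree)⟩
  have hσ' : σ'.Injective := fun i k hik => hσ (congrArg Subtype.val hik)
  have hτ' : τ'.Injective := fun j k hjk => hτ (congrArg Subtype.val hjk)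
  have hbij : σ'.Bijective := hσ'.bijective_of_nat_card_le (Nat.card_le_card_of_injective τ' hτ')
  exact exists_equiv_of_subtype (r := fun i j => Iso (summand A (N i)) (summand A (N' j))) e
    (.ofBijective σ' hbij) (fun i => Iso.trans i.2 (e i).2.symm) hσN

end IsDirectSum

end Uniqueness

end SubPair

theorem mainTheorem4 {Λ : Type u} [CommRing Λ] [IsDomain Λ] [IsPrincipalIdealRing Λ]
    (p : Λ) (hp : Prime p)
    {B : Type v} [AddCommGroup B] [Module Λ B] [Module.Finite Λ B]
    (A : Submodule Λ B) (hA : ∀ a ∈ A, p ^ 2 • a = 0) :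
    -- every pair of one of the listed types is indecomposable
    (∀ (M : Type u) [AddCommGroup M] [Module Λ M] (C : Submodule Λ M),
      SubPair.IsListed p C → SubPair.Indecomposable C) ∧
    -- existence of a decomposition into indecomposable pairs of the listed types
    (∃ (k : ℕ) (N : Fin k → Submodule Λ B), SubPair.IsDirectSum A N ∧
      ∀ i, SubPair.Indecomposable (SubPair.summand A (N i)) ∧
        SubPair.IsListed p (SubPair.summand A (N i))) ∧
    -- uniqueness among all finite decompositions into indecomposable pairs
    (∀ (k l : ℕ) (N : Fin k → Submodule Λ B) (N' : Fin l → Submodule Λ B),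
      SubPair.IsDirectSum A N → (∀ i, SubPair.Indecomposable (SubPair.summand A (N i))) →
      SubPair.IsDirectSum A N' → (∀ j, SubPair.Indecomposable (SubPair.summand A (N' j))) →
      ∃ σ : Fin k ≃ Fin l,
        ∀ i, SubPair.Iso (SubPair.summand A (N i)) (SubPair.summand A (N' (σ i)))) := by
  have hlisted (W : Submodule Λ B) (hW : SubPair.Indecomposable (SubPair.summand A W)) :
      SubPair.IsListed p (SubPair.summand A W) :=
    hW.isListed hp fun a ha => Subtype.ext (hA a ha)
  refine ⟨fun M _ _ C hC => hC.indecomposable hp, ?_, ?_⟩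
  · obtain ⟨k, N, hN, hNind⟩ := SubPair.exists_isDirectSum_indecomposable A
    exact ⟨k, N, hN, fun i => ⟨hNind i, hlisted _ (hNind i)⟩⟩
  · intro k l N N' hN hNind hN' hN'ind
    exact hN.exists_equiv hNind hN' hN'ind fun W hW =>
      (hlisted W hW).isFreeType_or_isTorsion hp.ne_zero
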